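/- Let $\mathbb H$ be a separable complex Hilbert space with a fixed complete orthonormal system $(e_j)$ (the "real" system); put $\overline x=\sum_j\overline{\langle x,e_j\rangle}e_j$, call $x$ real if $\overline x=x$, and let $[x\otimes y](z)=\langle z,y\rangle x$. Write $\|A\|_{\rm tr}=\sum_j\langle (A^*A)^{1/2}e_j,e_j\rangle$ and $\|A\|_{\rm HS}=\|A^*A\|_{\rm tr}^{1/2}$, and let $|\cdot|$ denote Lebesgue measure on $\mathbb R^d$. **Process (Assumption C).** Let $X=\{X(t),t\in\mathbb R^d\}$ be a zero-mean, real, second-order stationary process in $\mathbb H$: $\mathbb E\|X(t)\|^2<\infty$, and $\mathbb E[X(t)\otimes X(s)]$ and $\mathbb E[X(t)\otimes\overline{X(s)}]$ depend only on $t-s$. Let $C(h)=\mathbb E[X(t+h)\otimes X(t)]$. Assume that $\int_{\mathbb R^d}\|C(h)\|_{\rm tr}\,dh<\infty$ and that, for some $0<\gamma\le 1$ and some finite constant $M_C$, $$\int_{\mathbb R^d}\ \sup_{y:\|x-y\|\le\delta}\|C(y)-C(x)\|_{\rm tr}\,dx\le M_C\,\delta^\gamma\qquad\text{for all }\delta\in(0,1).$$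 Let $f(\theta)=(2\pi)^{-d}\int_{\mathbb R^d}e^{ih^\top\theta}C(h)\,dh$ be the spectral density. **Kernel (Assumption K).** Let $K:\mathbb R^d\to[0,\infty)$ be continuous, such that $S_K=\{u:K(u)>0\}$ is bounded and contains $0$, $\sup K=K(0)=1$, and, for some $\epsilon>0$, $K$ is differentiable with bounded gradient on $\{\|u\|<\epsilon\}$. Assume moreover that $K$ is Lipschitz on $\mathbb R^d$. **Sampling (Assumption S).** For each $n$ let $t_{n,1},\dots,t_{n,n}\in\mathbb R^d$ be distinct nonrandom points with closed convex hull $T_n$, let $V(t_{n,i})=\{x\in T_n:\|x-t_{n,i}\|\le\|x-t_{n,j}\|\ \forall j\}$ be their Voronoi cells, and let $\delta_n=\max_i\sup_{x\in V(t_{n,i})}\|x-t_{n,i}\|$. Assume that $\delta_n\to0$, that $|T_n|\to\infty$, and that $T_n/|T_n|^{1/d}$ converges in the Hausdorff metric to a fixed bounded convex set with nonempty interior. **Estimator.** For a bandwidth $\Delta_n$ let $$\hat f_n(\theta)=\frac1{(2\pi)^d}\sum_{i,j=1}^n e^{i(t_{n,i}-t_{n,j})^\top\theta}\,\frac{X(t_{n,i})\otimes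 X(t_{n,j})}{|T_n\cap(T_n-(t_{n,i}-t_{n,j}))|}\,K\!\Big(\frac{t_{n,i}-t_{n,j}}{\Delta_n}\Big)|V(t_{n,i})|\,|V(t_{n,j})|$$ (in the exponent $i$ is the imaginary unit; terms with $K=0$ are $0$). **Theorem.** Suppose that $\Delta_n\to\infty$, that $\Delta_n^d/|T_n|\to0$, and that $\Delta_n S_K\subset T_n-T_n$ for all sufficiently large $n$. Then, for every bounded $\Theta\subset\mathbb R^d$, $$\|\mathbb E\hat f_n(\theta)-f(\theta)\|_{\rm HS}=\mathcal O\big(\delta_n^\gamma+B_1(\Delta_n,\theta)+B_2(\Delta_n,\theta)\big)\qquad\text{uniformly in }\theta\in\Theta\text{ as }n\to\infty,$$ that is, there is a finite $M$ such that for all sufficiently large $n$ and all $\theta\in\Theta$ the left-hand side is at most $M(\delta_n^\gamma+B_1(\Delta_n,\theta)+B_2(\Delta_n,\theta))$, where $$B_1(\Delta_n,\theta)=\Big\|\int_{\Delta_nS_K}e^{ih^\top\theta}C(h)\big(1-K(h/\Delta_n)\big)dh\Big\|_{\rm HS},\qquad B_2(\Delta_n,\theta)=\Big\|\int_{\mathbb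 R^d\setminus\Delta_nS_K}e^{ih^\top\theta}C(h)\,dh\Big\|_{\rm HS}.$$ In particular, $\sup_{\theta\in\Theta}\|\mathbb E\hat f_n(\theta)-f(\theta)\|_{\rm HS}=\mathcal O\big(\delta_n^\gamma+\sup_{\theta\in\Theta}B_1(\Delta_n,\theta)+\sup_{\theta\in\Theta}B_2(\Delta_n,\theta)\big)$. -/

import Mathlib

open MeasureTheory Filter Topology
open scoped ENNReal NNReal Pointwise

noncomputable section

namespace SpectralBias

/-- The space of locations and frequencies: `ℝ^d` with the Euclidean norm. -/
abbrev E (d : ℕ) : Type := EuclideanSpace ℝ (Fin d)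

/-! ### Trace norm and Hilbert-Schmidt norm -/

section Operators

variable {H : Type*} [NormedAddCommGroup H] [InnerProductSpace ℂ H] [CompleteSpace H]
variable {ι : Type*}

/-- The trace norm `∑ⱼ ⟨(A* A)^{1/2} eⱼ, eⱼ⟩ ∈ [0, ∞]`, computed in a complete orthonormal system
`e` (its value does not depend on `e`). `CFC.abs A` is `(A* A)^{1/2}`; the summands are
nonnegative real numbers. -/
def traceNorm (e : HilbertBasis ι ℂ H) (A : H →L[ℂ] H) : ℝ≥0∞ :=
  ∑' j, ENNReal.ofReal (RCLike.re (inner ℂ (e j) (CFC.abs A (e j))))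

/-- The Hilbert-Schmidt norm `‖A* A‖_tr^{1/2} ∈ [0, ∞]`. -/
def hsNorm (e : HilbertBasis ι ℂ H) (A : H →L[ℂ] H) : ℝ≥0∞ :=
  traceNorm e (star A * A) ^ (1 / 2 : ℝ)

/-- The complex conjugate `∑ⱼ conj ⟨x, eⱼ⟩ eⱼ` of `x` with respect to the real system `e`. -/
def conjugate (e : HilbertBasis ι ℂ H) (x : H) : H := e.repr.symm (star (e.repr x))

end Operators

/-! ### Second-order stationary processes -/

section Covariance

variable {H : Type*} [NormedAddCommGroup H] [InnerProductSpace ℂ H] [CompleteSpace H]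
variable {ι Ω : Type*} [MeasurableSpace Ω] {d : ℕ}

/-- The covariance operator `C(t, s) = 𝔼[X(t) ⊗ X(s)]`, where `(x ⊗ y) z = ⟨z, y⟩ x` with the
inner product linear in its first slot, which is `InnerProductSpace.rankOne ℂ x y`. -/
def covOp (X : E d → Ω → H) (μ : Measure Ω) (t s : E d) : H →L[ℂ] H :=
  ∫ ω, InnerProductSpace.rankOne ℂ (X t ω) (X s ω) ∂μ

/-- The pseudo-covariance operator `𝔼[X(t) ⊗ conj X(s)]`. -/
def pseudoCovOp (e : HilbertBasis ι ℂ H) (X : E d → Ω → H) (μ : Measure Ω) (t s : E d) :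
    H →L[ℂ] H :=
  ∫ ω, InnerProductSpace.rankOne ℂ (X t ω) (conjugate e (X s ω)) ∂μ

/-- `X` is a zero-mean second-order stationary process with values in `H`: second moments are
finite, and covariance and pseudo-covariance depend only on the lag. -/
structure IsSecondOrderStationary (e : HilbertBasis ι ℂ H) (X : E d → Ω → H) (μ : Measure Ω) :
    Prop where
  memLp : ∀ t, MemLp (X t) 2 μ
  mean_zero : ∀ t, ∫ ω, X t ω ∂μ = 0
  cov_lag : ∀ t s t' s', t - s = t' - s' → covOp X μ t s = covOp X μ t' s'
  pseudoCov_lag : ∀ t s t' s', t - s = t' - s' → pseudoCovOp e X μ t s = pseudoCovOp e X μ t' s'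

/-- `X` is real with respect to the system `e`. -/
def IsRealProcess (e : HilbertBasis ι ℂ H) (X : E d → Ω → H) (μ : Measure Ω) : Prop :=
  ∀ t, ∀ᵐ ω ∂μ, conjugate e (X t ω) = X t ω

/-- The stationary covariance operator `C(h) = C(0 + h, 0)`. -/
def statCov (X : E d → Ω → H) (μ : Measure Ω) (h : E d) : H →L[ℂ] H := covOp X μ h 0

/-- The oscillation `sup_{y : ‖x - y‖ ≤ δ} ‖C(y) - C(x)‖_tr`. -/
def oscTr (e : HilbertBasis ι ℂ H) (C : E d → H →L[ℂ] H) (δ : ℝ) (x : E d) : ℝ≥0∞ :=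
  ⨆ (y : E d) (_ : ‖x - y‖ ≤ δ), traceNorm e (C y - C x)

/-- The condition on the covariance: `C` is integrable in trace norm and `L¹`-`γ`-Hölder. -/
structure CovarianceCondition (e : HilbertBasis ι ℂ H) (C : E d → H →L[ℂ] H) (γ : ℝ) : Prop where
  aestronglyMeasurable : AEStronglyMeasurable C volume
  integrable : ∫⁻ h, traceNorm e (C h) < ∞
  gamma_pos : 0 < γ
  gamma_le_one : γ ≤ 1
  holder : ∃ M : ℝ, ∀ δ : ℝ, 0 < δ → δ < 1 →
    AEMeasurable (oscTr e C δ) volume ∧ ∫⁻ x, oscTr e C δ x ≤ ENNReal.ofReal (M * δ ^ γ)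

/-- The character `exp(i h^⊤ θ)`. -/
def character (h θ : E d) : ℂ := Complex.exp (Complex.I * ((inner ℝ h θ : ℝ) : ℂ))

/-- The spectral density `f(θ) = (2π)^{-d} ∫ exp(i h^⊤ θ) C(h) dh`. -/
def spectralDensity (C : E d → H →L[ℂ] H) (θ : E d) : H →L[ℂ] H :=
  (((2 * Real.pi) ^ d)⁻¹ : ℝ) • ∫ h, character h θ • C h

end Covariance

/-! ### Sampling design -/

section Sampling

variable {d : ℕ}

/-- The sampling region: the closed convex hull of the observed locations. -/
def region {n : ℕ} (t : Fin n → E d) : Set (E d) := closure (convexHull ℝ (Set.range t))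

/-- The Lebesgue measure `|A|` as a real number. -/
def vol (A : Set (E d)) : ℝ := (volume A).toReal

/-- The Voronoi cell of `t i` in the sampling region. -/
def cell {n : ℕ} (t : Fin n → E d) (i : Fin n) : Set (E d) :=
  {x | x ∈ region t ∧ ∀ j, ‖x - t i‖ ≤ ‖x - t j‖}

/-- The diameter of the tessellation: `max_i sup_{x ∈ V(t_i)} ‖x - t_i‖`. -/
def meshSize {n : ℕ} (t : Fin n → E d) : ℝ :=
  sSup {r | ∃ i, ∃ x ∈ cell t i, r = ‖x - t i‖}

/-- The sampling condition for a triangular array of distinct locations `t n i`, `i = 1, …, n`: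
the mesh size tends to `0`, the volume of the sampling region tends to infinity, and the sampling
region, rescaled to unit volume, converges in the Hausdorff metric to a fixed bounded convex set
with nonempty interior. -/
structure SamplingCondition (t : (n : ℕ) → Fin n → E d) : Prop where
  distinct : ∀ n, Function.Injective (t n)
  mesh : Tendsto (fun n => meshSize (t n)) atTop (𝓝 0)
  volume_region : Tendsto (fun n => vol (region (t n))) atTop atTop
  shape : ∃ T : Set (E d), Bornology.IsBounded T ∧ Convex ℝ T ∧ (interior T).Nonempty ∧
    Tendsto (fun n => Metric.hausdorffEDist
      ((vol (region (t n)) ^ (1 / (d : ℝ)))⁻¹ • region (t n)) T) atTop (𝓝 0)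

end Sampling

/-! ### The kernel and the estimator -/

section Estimator

variable {d : ℕ}

/-- `S_K = {t : K(t) > 0}`. -/
def posSet (K : E d → ℝ) : Set (E d) := {u | 0 < K u}

/-- The condition on the kernel. -/
structure KernelCondition (K : E d → ℝ) : Prop where
  continuous : Continuous K
  nonneg : ∀ u, 0 ≤ K u
  bounded_support : Bornology.IsBounded (posSet K)
  zero_mem : (0 : E d) ∈ posSet K
  le_at_zero : ∀ u, K u ≤ K 0
  at_zero : K 0 = 1
  gradient_bound : ∃ ε : ℝ, 0 < ε ∧ (∀ u, ‖u‖ < ε → DifferentiableAt ℝ K u) ∧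
    ∃ M : ℝ, ∀ u, ‖u‖ < ε → ‖gradient K u‖ ≤ M

variable {H : Type*} [NormedAddCommGroup H] [InnerProductSpace ℂ H] [CompleteSpace H]
variable {ι Ω : Type*} [MeasurableSpace Ω]

/-- The estimator
`(2π)^{-d} ∑_{t,s} exp(i (t-s)^⊤ θ) (X(t) ⊗ X(s)) / |T ∩ (T - (t-s))| K((t-s)/Δ) |V(t)| |V(s)|`
based on the observations at `t 1, …, t n`, evaluated at the outcome `ω`. -/
def estimator (X : E d → Ω → H) (K : E d → ℝ) {n : ℕ} (t : Fin n → E d) (Δ : ℝ) (θ : E d)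
    (ω : Ω) : H →L[ℂ] H :=
  (((2 * Real.pi) ^ d)⁻¹ : ℝ) • ∑ i, ∑ j,
    (character (t i - t j) θ *
      ((K (Δ⁻¹ • (t i - t j)) * vol (cell t i) * vol (cell t j) /
        vol (region t ∩ (fun x => x - (t i - t j)) '' region t) : ℝ) : ℂ)) •
      InnerProductSpace.rankOne ℂ (X (t i) ω) (X (t j) ω)

/-- `B₁(Δ) = ‖∫_{h ∈ Δ S_K} exp(i h^⊤ θ) C(h) (1 - K(h/Δ)) dh‖_HS`. -/
def biasOne (e : HilbertBasis ι ℂ H) (C : E d → H →L[ℂ] H) (K : E d → ℝ) (Δ : ℝ) (θ : E d) :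
    ℝ≥0∞ :=
  hsNorm e (∫ h in Δ • posSet K, (character h θ * ((1 - K (Δ⁻¹ • h) : ℝ) : ℂ)) • C h)

/-- `B₂(Δ) = ‖∫_{h ∉ Δ S_K} exp(i h^⊤ θ) C(h) dh‖_HS`. -/
def biasTwo (e : HilbertBasis ι ℂ H) (C : E d → H →L[ℂ] H) (K : E d → ℝ) (Δ : ℝ) (θ : E d) :
    ℝ≥0∞ :=
  hsNorm e (∫ h in (Δ • posSet K)ᶜ, character h θ • C h)

end Estimator

end SpectralBias

end

noncomputable section

namespace SpectralBias

/-! ### Hilbert–Schmidt and trace norms. -/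

section HilbertSchmidt

variable {H : Type*} [NormedAddCommGroup H] [InnerProductSpace ℂ H]
variable {ι : Type*} (e : HilbertBasis ι ℂ H)

/-! By stationarity the expected estimator is, up to `(2π)^{-d}`, a double Riemann sum over pairs of
Voronoi cells for `∫_T ∫_T g(x - y) dx dy`, where `g(h) = e^{ih·θ} K(h/Δ) C(h) / |T ∩ (T - h)|`.
Fubini in the lag `h = x - y` produces the factor `|T ∩ (T - h)|`, which cancels the denominator
exactly (`integral_integral_sub`). What remains, `∫ e^{ih·θ} K(h/Δ) C(h) dh`, misses the integral
defining `f` precisely by the two bias integrals (`integral_kernel_sub`).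

The rest is quadrature error. Replacing `x - y` by `t_i - t_j` moves the lag by at most `2δ`, so by
`hsNorm_double_quadrature_le` the error is at most `|T|` times the integrated oscillation of `g`.
The scalar weight of `C` is `O(1/|T|)` with increments `O(δ/|T|)`, so the factor `|T|` disappears.
The oscillation of `C` contributes `δ^γ`, that of the weight `δ ≤ δ^γ`.

The weight bounds are convex geometry. Hausdorff convergence puts a ball of radius `ρ` of order
`|T|^{1/d}` inside `T`. Then `T` and `T + u` both lie in a dilate of `T` by `1 + ‖u‖/ρ`, so the
overlap varies by `O(|T| ‖u‖/ρ)`. Since `Δ = o(|T|^{1/d})`, it stays above `|T|/2` for all lags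
where the kernel is nonzero. -/

theorem tsum_enorm_inner_sq (x : H) : ∑' j, ‖inner ℂ (e j) x‖ₑ ^ 2 = ‖x‖ₑ ^ 2 := by
  have h := (e.hasSum_inner_mul_inner x x).mapL Complex.reCLM
  have hterm : ∀ j, Complex.reCLM (inner ℂ x (e j) * inner ℂ (e j) x)
      = ‖inner ℂ (e j) x‖ ^ 2 := fun j => by
    rw [← inner_conj_symm x (e j), ← Complex.normSq_eq_conj_mul_self, Complex.normSq_eq_norm_sq]
    simp [-Complex.ofReal_pow]
  simp only [hterm] at h
  have hx : Complex.reCLM (inner ℂ x x) = ‖x‖ ^ 2 := by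
    rw [inner_self_eq_norm_sq_to_K]
    simp [← Complex.ofReal_pow]
  rw [hx] at h
  have h2 := ENNReal.ofReal_tsum_of_nonneg (fun j => sq_nonneg ‖inner ℂ (e j) x‖) h.summable
  rw [h.tsum_eq] at h2
  simpa [ENNReal.ofReal_pow, ofReal_norm] using h2.symm

/-- The values of an operator on finitely many vectors of the basis, as an element of an `ℓ²`
space. -/
def coords (S : Finset ι) : (H →L[ℂ] H) →L[ℂ] PiLp 2 (fun _ : S => H) :=
  (PiLp.continuousLinearEquiv 2 ℂ (fun _ : S => H)).symm.toContinuousLinearMap ∘L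
    ContinuousLinearMap.pi fun j => ContinuousLinearMap.apply ℂ H (e j)

theorem enorm_coords_sq (S : Finset ι) (A : H →L[ℂ] H) :
    ‖coords e S A‖ₑ ^ 2 = ∑ j ∈ S, ‖A (e j)‖ₑ ^ 2 := by
  have h := PiLp.norm_sq_eq_of_L2 (fun _ : S => H) (coords e S A)
  have h2 := congrArg ENNReal.ofReal h
  rw [ENNReal.ofReal_pow (norm_nonneg _), ENNReal.ofReal_sum_of_nonneg
    (fun _ _ => by positivity), ofReal_norm] at h2
  rw [h2, ← Finset.sum_coe_sort S (fun j => ‖A (e j)‖ₑ ^ 2)]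
  refine Finset.sum_congr rfl fun j _ => ?_
  rw [ENNReal.ofReal_pow (norm_nonneg _), ofReal_norm]
  rfl

variable [CompleteSpace H]

theorem hsNorm_eq (A : H →L[ℂ] H) : hsNorm e A = (∑' j, ‖A (e j)‖ₑ ^ 2) ^ (1 / 2 : ℝ) := by
  unfold hsNorm traceNorm
  rw [CFC.abs_of_nonneg (star A * A) (star_mul_self_nonneg A)]
  congr 2
  ext j
  rw [mul_apply_eq_comp, ContinuousLinearMap.star_eq_adjoint,
    ContinuousLinearMap.adjoint_inner_right, inner_self_eq_norm_sq_to_K]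
  simp [← Complex.ofReal_pow, ENNReal.ofReal_pow, ofReal_norm]

theorem hsNorm_sq (A : H →L[ℂ] H) : hsNorm e A ^ 2 = ∑' j, ‖A (e j)‖ₑ ^ 2 := by
  rw [hsNorm_eq, ← ENNReal.rpow_natCast, ← ENNReal.rpow_mul]
  norm_num

theorem enorm_coords_le (S : Finset ι) (A : H →L[ℂ] H) : ‖coords e S A‖ₑ ≤ hsNorm e A := by
  rw [← ENNReal.pow_le_pow_left_iff two_ne_zero, enorm_coords_sq, hsNorm_sq]
  exact ENNReal.sum_le_tsum S

/-- The Hilbert–Schmidt norm is the supremum of norms of bounded linear images in finite `ℓ²` sums,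
so subadditivity and the integral inequality are inherited from normed spaces, infinite values
included. -/
theorem hsNorm_le_of_coords {A : H →L[ℂ] H} {b : ℝ≥0∞}
    (h : ∀ S : Finset ι, ‖coords e S A‖ₑ ≤ b) : hsNorm e A ≤ b := by
  rw [← ENNReal.pow_le_pow_left_iff two_ne_zero, hsNorm_sq, ENNReal.tsum_eq_iSup_sum]
  refine iSup_le fun S => ?_
  rw [← enorm_coords_sq]
  exact pow_le_pow_left' (h S) 2

theorem hsNorm_add_le (A B : H →L[ℂ] H) : hsNorm e (A + B) ≤ hsNorm e A + hsNorm e B :=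
  hsNorm_le_of_coords e fun S => by
    rw [map_add]
    exact (enorm_add_le _ _).trans (add_le_add (enorm_coords_le e S A) (enorm_coords_le e S B))

theorem hsNorm_zero : hsNorm e (0 : H →L[ℂ] H) = 0 :=
  le_antisymm (hsNorm_le_of_coords e fun S => by simp) zero_le

theorem hsNorm_smul_le (c : ℂ) (A : H →L[ℂ] H) : hsNorm e (c • A) ≤ ‖c‖ₑ * hsNorm e A :=
  hsNorm_le_of_coords e fun S => by
    rw [map_smul, enorm_smul]
    gcongr
    exact enorm_coords_le e S A

theorem hsNorm_real_smul_le (c : ℝ) (A : H →L[ℂ] H) : hsNorm e (c • A) ≤ ‖c‖ₑ * hsNorm e A := by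
  have h := hsNorm_smul_le e (c : ℂ) A
  rw [Complex.coe_smul] at h
  simpa [← ofReal_norm] using h

theorem hsNorm_neg (A : H →L[ℂ] H) : hsNorm e (-A) = hsNorm e A := by
  simp [hsNorm_eq]

theorem hsNorm_sum_le {κ : Type*} (s : Finset κ) (A : κ → H →L[ℂ] H) :
    hsNorm e (∑ k ∈ s, A k) ≤ ∑ k ∈ s, hsNorm e (A k) :=
  Finset.le_sum_of_subadditive _ (hsNorm_zero e).le (hsNorm_add_le e) s A

theorem hsNorm_integral_le {α : Type*} [MeasurableSpace α] (ν : Measure α)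
    (F : α → H →L[ℂ] H) : hsNorm e (∫ x, F x ∂ν) ≤ ∫⁻ x, hsNorm e (F x) ∂ν := by
  by_cases hF : Integrable F ν
  · refine hsNorm_le_of_coords e fun S => ?_
    rw [← ContinuousLinearMap.integral_comp_comm _ hF]
    exact (enorm_integral_le_lintegral_enorm _).trans
      (lintegral_mono fun x => enorm_coords_le e S (F x))
  · rw [integral_undef hF, hsNorm_zero]
    exact zero_le

/-- Parseval for `A* y`, with `⟨e_j, A* y⟩ = ⟨A e_j, y⟩` and Cauchy–Schwarz in each term, bounds the
adjoint. -/
theorem enorm_le_hsNorm (A : H →L[ℂ] H) : ‖A‖ₑ ≤ hsNorm e A := by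
  by_cases htop : hsNorm e A = ∞
  · simp [htop]
  have hadj : ∀ y, ‖ContinuousLinearMap.adjoint A y‖ₑ ≤ hsNorm e A * ‖y‖ₑ := fun y => by
    rw [← ENNReal.pow_le_pow_left_iff two_ne_zero, mul_pow, hsNorm_sq, ← ENNReal.tsum_mul_right,
      ← tsum_enorm_inner_sq e]
    refine ENNReal.tsum_le_tsum fun j => ?_
    rw [ContinuousLinearMap.adjoint_inner_right, ← mul_pow]
    refine pow_le_pow_left' ?_ 2
    rw [← ofReal_norm, ← ofReal_norm, ← ofReal_norm, ← ENNReal.ofReal_mul (norm_nonneg _)]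
    exact ENNReal.ofReal_le_ofReal (norm_inner_le_norm _ _)
  have hle : ‖ContinuousLinearMap.adjoint A‖ ≤ (hsNorm e A).toReal := by
    refine ContinuousLinearMap.opNorm_le_bound _ ENNReal.toReal_nonneg fun y => ?_
    have := ENNReal.toReal_mono (ENNReal.mul_ne_top htop enorm_ne_top) (hadj y)
    rwa [ENNReal.toReal_mul, toReal_enorm, toReal_enorm] at this
  rw [LinearIsometryEquiv.norm_map] at hle
  rw [← ofReal_norm]
  exact ENNReal.ofReal_le_of_le_toReal hle

/-- With `P = |A| = Q²`, one has `‖A e_j‖ = ‖P e_j‖` and `⟨e_k, P e_j⟩ = ⟨Q e_k, Q e_j⟩`. Parseval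
and Cauchy–Schwarz give at most `∑_{j,k} ‖Q e_j‖² ‖Q e_k‖²`, the square of the trace norm. -/
theorem hsNorm_le_traceNorm (A : H →L[ℂ] H) : hsNorm e A ≤ traceNorm e A := by
  set P := CFC.abs A with hP
  have hP0 : 0 ≤ P := CFC.abs_nonneg A
  set Q := CFC.sqrt P with hQ
  have hQ0 : 0 ≤ Q := CFC.sqrt_nonneg P
  have hQQ : Q * Q = P := CFC.sqrt_mul_sqrt_self P hP0
  have hQsa : ContinuousLinearMap.adjoint Q = Q := by
    rw [← ContinuousLinearMap.star_eq_adjoint]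
    exact (IsSelfAdjoint.of_nonneg hQ0).star_eq
  have hPsa : ContinuousLinearMap.adjoint P = P := by
    rw [← ContinuousLinearMap.star_eq_adjoint]
    exact (IsSelfAdjoint.of_nonneg hP0).star_eq
  have hPQ : ∀ x y, inner ℂ x (P y) = inner ℂ (Q x) (Q y) := fun x y => by
    rw [← hQQ, mul_apply_eq_comp, ← ContinuousLinearMap.adjoint_inner_left, hQsa]
  have htr : traceNorm e A = ∑' j, ‖Q (e j)‖ₑ ^ 2 := by
    unfold traceNorm
    refine tsum_congr fun j => ?_
    rw [← hP, hPQ, inner_self_eq_norm_sq_to_K]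
    simp [← Complex.ofReal_pow, ENNReal.ofReal_pow, ofReal_norm]
  have hAP : ∀ x, ‖A x‖ₑ = ‖P x‖ₑ := fun x => by
    have h1 : inner ℂ (A x) (A x) = inner ℂ (P x) (P x) := by
      have h := CFC.abs_mul_abs A
      rw [← ContinuousLinearMap.adjoint_inner_right, ← ContinuousLinearMap.star_eq_adjoint,
        ← mul_apply_eq_comp, ← h, mul_apply_eq_comp, ← hP]
      conv_lhs => rw [← ContinuousLinearMap.adjoint_inner_left, hPsa]
    have h2 : ‖A x‖ = ‖P x‖ := by
      rw [@norm_eq_sqrt_re_inner ℂ, @norm_eq_sqrt_re_inner ℂ, h1]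
    rw [← ofReal_norm, h2, ofReal_norm]
  rw [← ENNReal.pow_le_pow_left_iff two_ne_zero, hsNorm_sq, htr, sq, ← ENNReal.tsum_mul_right]
  refine ENNReal.tsum_le_tsum fun j => ?_
  rw [hAP, ← tsum_enorm_inner_sq e (P (e j)), ← ENNReal.tsum_mul_left]
  refine ENNReal.tsum_le_tsum fun k => ?_
  rw [hPQ, ← mul_pow]
  refine pow_le_pow_left' ?_ 2
  rw [mul_comm, ← ofReal_norm, ← ofReal_norm, ← ofReal_norm, ← ENNReal.ofReal_mul (norm_nonneg _)]
  exact ENNReal.ofReal_le_ofReal (norm_inner_le_norm _ _)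

end HilbertSchmidt

/-! ### Overlaps of a convex body with its translates. -/

section ConvexBodies

variable {d : ℕ}

/-- The volume `|T ∩ (T - h)|`. -/
def overlap (T : Set (E d)) (h : E d) : ℝ := vol (T ∩ (fun x => x - h) '' T)

theorem vol_nonneg (A : Set (E d)) : 0 ≤ vol A := ENNReal.toReal_nonneg

theorem overlap_eq (T : Set (E d)) (h : E d) : overlap T h = vol {x | x ∈ T ∧ x + h ∈ T} := by
  unfold overlap
  congr 1
  ext x
  simp [sub_eq_iff_eq_add]

theorem overlap_zero (T : Set (E d)) : overlap T 0 = vol T := by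
  simp [overlap_eq]

theorem measurable_overlap {T : Set (E d)} (hT : MeasurableSet T) : Measurable (overlap T) := by
  have hset : MeasurableSet {p : E d × E d | p.2 ∈ T ∧ p.2 + p.1 ∈ T} :=
    (measurable_snd hT).inter ((measurable_snd.add measurable_fst) hT)
  have h := (measurable_measure_prodMk_left (ν := (volume : Measure (E d))) hset).ennreal_toReal
  convert h using 1
  ext x
  rw [overlap_eq]
  rfl

theorem one_add_pow_le {ε : ℝ} (h0 : 0 ≤ ε) (h1 : ε ≤ 1) (m : ℕ) :
    (1 + ε) ^ m ≤ 1 + (2 ^ m - 1) * ε := by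
  induction m with
  | zero => simp
  | succ m ih =>
    have h2 : (1 : ℝ) ≤ 2 ^ m := one_le_pow₀ (by norm_num)
    rw [pow_succ, pow_succ]
    have h3 : (2 ^ m - 1) * (ε * ε) ≤ (2 ^ m - 1) * (ε * 1) := by
      have : ε * ε ≤ ε * 1 := by gcongr
      exact mul_le_mul_of_nonneg_left this (by linarith)
    have h4 := mul_le_mul_of_nonneg_right ih (show 0 ≤ 1 + ε by linarith)
    linarith

/-- The preimage is the convex combination `(s + ε(x₀ + v)) / (1 + ε)`. -/
theorem add_mem_homothety {T : Set (E d)} (hT : Convex ℝ T) {x₀ v s : E d} {ε : ℝ} (hε : 0 ≤ ε)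
    (hv : x₀ + v ∈ T) (hs : s ∈ T) : s + ε • v ∈ AffineMap.homothety x₀ (1 + ε) '' T := by
  have hpos : 0 < 1 + ε := by linarith
  refine ⟨(1 + ε)⁻¹ • s + (ε * (1 + ε)⁻¹) • (x₀ + v), hT hs hv (by positivity) (by positivity)
    (by field_simp), ?_⟩
  simp only [AffineMap.homothety_apply, vsub_eq_sub, vadd_eq_add]
  match_scalars <;> field_simp
  ring

/-- The disjoint sets `(T + u) \ T` and `T` both lie in the dilate of `T` about `x₀` by `1 + ‖u‖/ρ`,
whose volume is `(1 + ‖u‖/ρ)^d |T|`. -/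
theorem vol_translate_diff_le {T : Set (E d)} (hT : Convex ℝ T) (hm : MeasurableSet T)
    (hfin : volume T ≠ ∞) {x₀ : E d} {ρ : ℝ} (hρ : 0 < ρ) (hball : Metric.closedBall x₀ ρ ⊆ T)
    {u : E d} (hu : ‖u‖ ≤ ρ) :
    vol {y | y - u ∈ T ∧ y ∉ T} ≤ 2 ^ d * (‖u‖ / ρ) * vol T := by
  set ε := ‖u‖ / ρ with hεdef
  have hε0 : 0 ≤ ε := by positivity
  have hε1 : ε ≤ 1 := (div_le_one hρ).2 hu
  -- The vector `ε⁻¹ • u` has length `ρ`, or is zero when `u = 0`, where `0⁻¹ = 0` is harmless.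
  have huv : u = ε • (ε⁻¹ • u) := by
    by_cases h : ε = 0
    · have : u = 0 := by
        rcases div_eq_zero_iff.1 h with h | h
        · exact norm_eq_zero.1 h
        · exact absurd h hρ.ne'
      simp [this]
    · rw [smul_smul, mul_inv_cancel₀ h, one_smul]
  have hv : x₀ + ε⁻¹ • u ∈ T := by
    refine hball ?_
    rw [mem_closedBall_iff_norm, add_sub_cancel_left, norm_smul, Real.norm_eq_abs,
      abs_of_nonneg (inv_nonneg.2 hε0), hεdef, inv_div]
    by_cases h : ‖u‖ = 0
    · simp [h, hρ.le]
    · rw [div_mul_cancel₀ _ h]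
  have hx₀ : x₀ + 0 ∈ T := by
    simpa using hball (Metric.mem_closedBall_self hρ.le)
  set D := {y | y - u ∈ T ∧ y ∉ T} with hD
  have hdisj : Disjoint D T := Set.disjoint_left.2 fun y hy => hy.2
  have hsub : D ∪ T ⊆ AffineMap.homothety x₀ (1 + ε) '' T := by
    rintro y (hy | hy)
    · have := add_mem_homothety hT hε0 hv hy.1
      rwa [← huv, sub_add_cancel] at this
    · have := add_mem_homothety hT hε0 hx₀ hy
      rwa [smul_zero, add_zero] at this
  have hle := measure_mono (μ := volume) hsub
  rw [measure_union hdisj hm, Measure.addHaar_image_homothety, finrank_euclideanSpace_fin] at hle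
  have hDfin : volume D ≠ ∞ := by
    have hlt := hle.trans_lt (ENNReal.mul_lt_top ENNReal.ofReal_lt_top hfin.lt_top)
    exact ((self_le_add_right _ _).trans_lt hlt).ne
  have hle2 := ENNReal.toReal_mono (ENNReal.mul_ne_top ENNReal.ofReal_ne_top hfin) hle
  rw [ENNReal.toReal_add hDfin hfin, ENNReal.toReal_mul, ENNReal.toReal_ofReal (abs_nonneg _),
    abs_of_nonneg (by positivity)] at hle2
  change vol D + vol T ≤ (1 + ε) ^ d * vol T at hle2
  have h3 := mul_le_mul_of_nonneg_right (one_add_pow_le hε0 hε1 d) (vol_nonneg T)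
  have h4 : 0 ≤ ε * vol T := mul_nonneg hε0 (vol_nonneg T)
  linarith

/-- A point lost on passing from `h` to `h'`, translated by `h'`, lands in `(T + (h' - h)) \ T`. -/
theorem overlap_sub_le {T : Set (E d)} (hT : Convex ℝ T) (hm : MeasurableSet T)
    (hfin : volume T ≠ ∞) {x₀ : E d} {ρ : ℝ} (hρ : 0 < ρ) (hball : Metric.closedBall x₀ ρ ⊆ T)
    {h h' : E d} (hu : ‖h' - h‖ ≤ ρ) :
    overlap T h - overlap T h' ≤ 2 ^ d * (‖h' - h‖ / ρ) * vol T := by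
  refine le_trans ?_ (vol_translate_diff_le hT hm hfin hρ hball hu)
  rw [overlap_eq, overlap_eq, sub_le_iff_le_add']
  have hpre : vol {x | x + h ∈ T ∧ x + h' ∉ T} = vol {y | y - (h' - h) ∈ T ∧ y ∉ T} := by
    unfold vol
    rw [← measure_preimage_add_right volume h' {y | y - (h' - h) ∈ T ∧ y ∉ T}]
    congr 3
    ext x
    rw [show x + h = x + h' - (h' - h) by abel]
    rfl
  have hfin1 : volume {x | x ∈ T ∧ x + h' ∈ T} ≠ ∞ := measure_ne_top_of_subset (fun x hx => hx.1) hfin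
  have hfin2 : volume {x | x + h ∈ T ∧ x + h' ∉ T} ≠ ∞ := by
    have hsub : {x | x + h ∈ T ∧ x + h' ∉ T} ⊆ (fun x => x + h) ⁻¹' T := fun x hx => hx.1
    refine measure_ne_top_of_subset hsub ?_
    rwa [measure_preimage_add_right]
  rw [← hpre]
  unfold vol
  rw [← ENNReal.toReal_add hfin1 hfin2]
  refine ENNReal.toReal_mono (ENNReal.add_ne_top.2 ⟨hfin1, hfin2⟩)
    ((measure_mono fun x hx => ?_).trans (measure_union_le _ _))
  by_cases hx' : x + h' ∈ T
  · exact Or.inl ⟨hx.1, hx'⟩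
  · exact Or.inr ⟨hx.2, hx'⟩

theorem abs_overlap_sub_le {T : Set (E d)} (hT : Convex ℝ T) (hm : MeasurableSet T)
    (hfin : volume T ≠ ∞) {x₀ : E d} {ρ : ℝ} (hρ : 0 < ρ) (hball : Metric.closedBall x₀ ρ ⊆ T)
    {h h' : E d} (hu : ‖h' - h‖ ≤ ρ) :
    |overlap T h' - overlap T h| ≤ 2 ^ d * (‖h' - h‖ / ρ) * vol T := by
  rw [abs_sub_comm, abs_le']
  refine ⟨overlap_sub_le hT hm hfin hρ hball hu, ?_⟩
  rw [neg_sub, norm_sub_rev]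
  exact overlap_sub_le hT hm hfin hρ hball (by rwa [norm_sub_rev])

/-- If `z` were outside `S`, a hyperplane would separate it from `S`. Moving `z` by `r` along the
normal stays in `T`, and any point within less than `r` of the result lies beyond the hyperplane,
hence not in `S`. -/
theorem closedBall_subset_of_hausdorffEDist_lt {S T : Set (E d)} (hS : Convex ℝ S)
    (hc : IsClosed S) {x₀ : E d} {r : ℝ} (hr : 0 < r) (hball : Metric.closedBall x₀ (2 * r) ⊆ T)
    (hd : Metric.hausdorffEDist S T < ENNReal.ofReal r) : Metric.closedBall x₀ r ⊆ S := by
  intro z hz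
  by_contra hzS
  obtain ⟨f, u, hfu, huz⟩ := geometric_hahn_banach_closed_point hS hc hzS
  obtain ⟨v, rfl⟩ := (InnerProductSpace.toDual ℝ (E d)).surjective f
  simp only [InnerProductSpace.toDual_apply_apply] at hfu huz
  have hnorm : ‖(r / ‖v‖) • v‖ ≤ r := by
    rw [norm_smul, Real.norm_eq_abs, abs_of_nonneg (by positivity)]
    by_cases hv : ‖v‖ = 0
    · simp [hv, hr.le]
    · rw [div_mul_cancel₀ _ hv]
  have hp : z + (r / ‖v‖) • v ∈ T := by
    refine hball ?_
    rw [mem_closedBall_iff_norm] at hz ⊢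
    calc ‖z + (r / ‖v‖) • v - x₀‖ = ‖(z - x₀) + (r / ‖v‖) • v‖ := by congr 1; abel
      _ ≤ 2 * r := (norm_add_le _ _).trans (by linarith)
  rw [Metric.hausdorffEDist_comm] at hd
  obtain ⟨s, hs, hps⟩ := Metric.exists_edist_lt_of_hausdorffEDist_lt hp hd
  rw [edist_dist, ENNReal.ofReal_lt_ofReal_iff hr, dist_eq_norm] at hps
  have hlt : inner ℝ v s < inner ℝ v z := (hfu s hs).trans huz
  have hv : v ≠ 0 := by
    rintro rfl
    simp at hlt
  have hvpos : 0 < ‖v‖ := norm_pos_iff.2 hv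
  have h1 := real_inner_le_norm v (z + (r / ‖v‖) • v - s)
  rw [inner_sub_right, inner_add_right, real_inner_smul_right, real_inner_self_eq_norm_sq,
    show r / ‖v‖ * ‖v‖ ^ 2 = ‖v‖ * r by field_simp] at h1
  have h2 := mul_lt_mul_of_pos_left hps hvpos
  linarith

end ConvexBodies

/-! ### Voronoi cells as an almost disjoint partition. -/

section Voronoi

variable {d n : ℕ} (t : Fin n → E d)

theorem isClosed_region : IsClosed (region t) := isClosed_closure

theorem convex_region : Convex ℝ (region t) := (convex_convexHull ℝ _).closure

theorem isBounded_region : Bornology.IsBounded (region t) :=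
  (isBounded_convexHull.2 (Set.finite_range t).isBounded).closure

theorem volume_region_ne_top : volume (region t) ≠ ∞ := (isBounded_region t).measure_lt_top.ne

theorem isClosed_cell (i : Fin n) : IsClosed (cell t i) := by
  have : cell t i = region t ∩ ⋂ j, {x | ‖x - t i‖ ≤ ‖x - t j‖} := by
    ext x
    simp [cell]
  rw [this]
  exact (isClosed_region t).inter (isClosed_iInter fun j => isClosed_le (by fun_prop) (by fun_prop))

theorem cell_subset (i : Fin n) : cell t i ⊆ region t := fun _ hx => hx.1

theorem volume_cell_ne_top (i : Fin n) : volume (cell t i) ≠ ∞ :=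
  measure_ne_top_of_subset (cell_subset t i) (volume_region_ne_top t)

theorem meshSize_nonneg : 0 ≤ meshSize t :=
  Real.sSup_nonneg (by rintro _ ⟨i, x, -, rfl⟩; exact norm_nonneg _)

theorem norm_sub_le_meshSize {i : Fin n} {x : E d} (hx : x ∈ cell t i) :
    ‖x - t i‖ ≤ meshSize t := by
  refine le_csSup ?_ ⟨i, x, hx, rfl⟩
  refine ⟨Metric.diam (region t), ?_⟩
  rintro _ ⟨j, y, hy, rfl⟩
  rw [← dist_eq_norm]
  exact Metric.dist_le_diam_of_mem (isBounded_region t) hy.1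
    (subset_closure (subset_convexHull ℝ _ ⟨j, rfl⟩))

theorem iUnion_cell : ⋃ i, cell t i = region t := by
  refine Set.Subset.antisymm (Set.iUnion_subset (cell_subset t)) fun x hx => ?_
  have hne : Nonempty (Fin n) := by
    by_contra h
    rw [not_nonempty_iff] at h
    simp [region, Set.range_eq_empty] at hx
  obtain ⟨i, hi⟩ := Finite.exists_min fun i => ‖x - t i‖
  exact Set.mem_iUnion.2 ⟨i, hx, hi⟩

theorem volume_perpBisector {p q : E d} (h : p ≠ q) :
    volume (AffineSubspace.perpBisector p q : Set (E d)) = 0 :=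
  Measure.addHaar_affineSubspace _ _ (by simpa using h)

variable {t}

/-- Two cells meet only inside the perpendicular bisector of their distinct centres, a null set. -/
theorem restrict_region (ht : Function.Injective t) :
    volume.restrict (region t) = Measure.sum fun i => volume.restrict (cell t i) := by
  rw [← iUnion_cell]
  refine Measure.restrict_iUnion_ae (fun i j hij => ?_)
    fun i => (isClosed_cell t i).measurableSet.nullMeasurableSet
  refine measure_mono_null (fun x hx => ?_) (volume_perpBisector (ht.ne hij))
  rw [SetLike.mem_coe, AffineSubspace.mem_perpBisector_iff_dist_eq, dist_eq_norm, dist_eq_norm]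
  exact le_antisymm (hx.1.2 j) (hx.2.2 i)

/-- Mesh size zero would make the region a finite set. Positivity is needed because the Hölder
condition is only stated for `δ > 0`. -/
theorem meshSize_pos [NullSingletonClass (volume : Measure (E d))] (hv : 0 < vol (region t)) :
    0 < meshSize t := by
  refine lt_of_le_of_ne (meshSize_nonneg t) fun h => ?_
  have hsub : region t ⊆ Set.range t := by
    rw [← iUnion_cell]
    refine Set.iUnion_subset fun i x hx => ⟨i, ?_⟩
    have := norm_sub_le_meshSize t hx
    rw [← h] at this
    exact (sub_eq_zero.1 (norm_le_zero_iff.1 this)).symm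
  have : volume (region t) = 0 := measure_mono_null hsub ((Set.finite_range t).measure_zero volume)
  simp [vol, this] at hv

end Voronoi

/-! ### Riemann sums over pairs of cells. -/

section Quadrature

variable {H : Type*} [NormedAddCommGroup H] [InnerProductSpace ℂ H]
variable {ι : Type*} (e : HilbertBasis ι ℂ H) {d n : ℕ} {t : Fin n → E d}

theorem integral_region (ht : Function.Injective t) {F : E d → H →L[ℂ] H}
    (hF : IntegrableOn F (region t)) : ∫ x in region t, F x = ∑ i, ∫ x in cell t i, F x := by
  rw [restrict_region ht, Measure.sum_fintype, integral_finsetSum_measure]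
  exact fun i _ => hF.mono_set (cell_subset t i)

theorem lintegral_region (ht : Function.Injective t) (b : E d → ℝ≥0∞) :
    ∫⁻ x in region t, b x = ∑ i, ∫⁻ x in cell t i, b x := by
  rw [restrict_region ht, lintegral_sum_measure, tsum_fintype]

theorem volume_region (ht : Function.Injective t) :
    volume (region t) = ∑ i, volume (cell t i) := by
  simpa using lintegral_region ht fun _ => 1

theorem hsNorm_quadrature_le [CompleteSpace H] (ht : Function.Injective t) {F : E d → H →L[ℂ] H}
    (hF : IntegrableOn F (region t)) (a : Fin n → H →L[ℂ] H) :
    hsNorm e (∑ i, vol (cell t i) • a i - ∫ x in region t, F x) ≤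
      ∑ i, ∫⁻ x in cell t i, hsNorm e (a i - F x) := by
  rw [integral_region ht hF, ← Finset.sum_sub_distrib]
  refine (hsNorm_sum_le e _ _).trans (Finset.sum_le_sum fun i _ => ?_)
  have hconst : vol (cell t i) • a i = ∫ _ in cell t i, a i := by
    rw [setIntegral_const]
    rfl
  have hint : IntegrableOn (fun _ => a i) (cell t i) := integrableOn_const (volume_cell_ne_top t i)
  rw [hconst, ← integral_sub hint (hF.mono_set (cell_subset t i))]
  exact hsNorm_integral_le e _ _

/-- The integrand of `∫_T ∫_T g(x - y) dx dy` in the coordinates `(y, x - y)`. -/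
def lagIntegrand (T : Set (E d)) (g : E d → H →L[ℂ] H) : E d × E d → H →L[ℂ] H :=
  {p : E d × E d | p.1 ∈ T ∧ p.1 + p.2 ∈ T}.indicator fun p => g p.2

variable {T : Set (E d)} {g : E d → H →L[ℂ] H}

theorem integrable_lagIntegrand [CompleteSpace H] (hm : MeasurableSet T) (hfin : volume T ≠ ∞)
    (hg : Integrable g) : Integrable (lagIntegrand T g) (volume.prod volume) := by
  have hset : MeasurableSet {p : E d × E d | p.1 ∈ T ∧ p.1 + p.2 ∈ T} :=
    (measurable_fst hm).inter ((measurable_fst.add measurable_snd) hm)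
  unfold lagIntegrand
  rw [integrable_indicator_iff hset]
  have hle : IntegrableOn (fun p : E d × E d => g p.2) (T ×ˢ Set.univ) (volume.prod volume) := by
    unfold IntegrableOn
    rw [← Measure.prod_restrict, Measure.restrict_univ]
    have : IsFiniteMeasure (volume.restrict T) := ⟨by simpa using hfin.lt_top⟩
    exact hg.comp_snd _
  exact hle.mono_set fun p hp => ⟨hp.1, trivial⟩

theorem integral_lagIntegrand_left (hm : MeasurableSet T) (y : E d) :
    ∫ h, lagIntegrand T g (y, h) = T.indicator (fun y => ∫ x in T, g (x - y)) y := by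
  by_cases hy : y ∈ T
  · rw [Set.indicator_of_mem hy, ← integral_indicator hm,
      ← integral_add_left_eq_self (T.indicator fun x => g (x - y)) y]
    congr 1
    ext1 h
    by_cases hh : y + h ∈ T <;> simp [lagIntegrand, Set.indicator, hy, hh]
  · rw [Set.indicator_of_notMem hy]
    simp [lagIntegrand, Set.indicator, hy]

theorem integral_lagIntegrand_right [CompleteSpace H] (hm : MeasurableSet T) (h : E d) :
    ∫ y, lagIntegrand T g (y, h) = overlap T h • g h := by
  have hset : MeasurableSet {x | x ∈ T ∧ x + h ∈ T} := hm.inter ((measurable_add_const h) hm)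
  rw [overlap_eq]
  have : ∀ y, lagIntegrand T g (y, h) = {x | x ∈ T ∧ x + h ∈ T}.indicator (fun _ => g h) y :=
    fun y => rfl
  simp_rw [this]
  rw [integral_indicator hset, setIntegral_const]
  rfl

theorem integrableOn_integral_sub [CompleteSpace H] (hm : MeasurableSet T) (hfin : volume T ≠ ∞)
    (hg : Integrable g) : IntegrableOn (fun y => ∫ x in T, g (x - y)) T := by
  rw [← integrable_indicator_iff hm]
  have := (integrable_lagIntegrand hm hfin hg).integral_prod_left
  simpa only [integral_lagIntegrand_left hm] using this

/-- Fubini in the coordinates `(y, x - y)`: the `y` compatible with lag `h` form `T ∩ (T - h)`. -/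
theorem integral_integral_sub [CompleteSpace H] (hm : MeasurableSet T) (hfin : volume T ≠ ∞)
    (hg : Integrable g) :
    ∫ y in T, ∫ x in T, g (x - y) = ∫ h, overlap T h • g h := by
  have := integral_integral_swap (f := fun y h => lagIntegrand T g (y, h))
    (integrable_lagIntegrand hm hfin hg)
  simp only [integral_lagIntegrand_left hm, integral_lagIntegrand_right hm] at this
  rw [← this, integral_indicator hm]

/-- Quadrature is applied in `y`, then in `x`. For fixed `y` the inner error is at most `∫ b(x - y)
dx = ∫ b`, independently of `y`, so the outer integration costs only a factor `|T|`. -/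
theorem hsNorm_double_quadrature_le [CompleteSpace H] (ht : Function.Injective t)
    (hg : Integrable g)
    {b : E d → ℝ≥0∞} (hb : ∀ h h', ‖h - h'‖ ≤ 2 * meshSize t → hsNorm e (g h' - g h) ≤ b h) :
    hsNorm e (∑ j, vol (cell t j) • ∑ i, vol (cell t i) • g (t i - t j) -
      ∫ h, overlap (region t) h • g h) ≤ volume (region t) * ∫⁻ h, b h := by
  have hm := (isClosed_region t).measurableSet
  have hfin := volume_region_ne_top t
  rw [← integral_integral_sub hm hfin hg]
  refine (hsNorm_quadrature_le e ht (integrableOn_integral_sub hm hfin hg) _).trans ?_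
  rw [volume_region ht, Finset.sum_mul]
  refine Finset.sum_le_sum fun j _ => ?_
  rw [mul_comm, ← setLIntegral_const]
  refine setLIntegral_mono' (isClosed_cell t j).measurableSet fun y hy => ?_
  refine (hsNorm_quadrature_le e ht (hg.comp_sub_right y).integrableOn _).trans ?_
  rw [← lintegral_sub_right_eq_self b y]
  refine le_trans ?_ (setLIntegral_le_lintegral (region t) _)
  rw [lintegral_region ht]
  refine Finset.sum_le_sum fun i _ => ?_
  refine setLIntegral_mono' (isClosed_cell t i).measurableSet fun x hx => hb _ _ ?_
  calc ‖x - y - (t i - t j)‖ = ‖(x - t i) - (y - t j)‖ := by congr 1; abel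
    _ ≤ ‖x - t i‖ + ‖y - t j‖ := norm_sub_le _ _
    _ ≤ 2 * meshSize t := by
      linarith [norm_sub_le_meshSize t hx, norm_sub_le_meshSize t hy]

end Quadrature

/-! ### Size and increments of the lag weight. -/

section Weights

variable {d : ℕ}

theorem norm_character (h θ : E d) : ‖character h θ‖ = 1 := by
  unfold character
  rw [mul_comm, Complex.norm_exp_ofReal_mul_I]

theorem continuous_character (θ : E d) : Continuous fun h => character h θ := by
  unfold character
  fun_prop

theorem norm_character_sub_le (h h' θ : E d) :
    ‖character h' θ - character h θ‖ ≤ ‖h' - h‖ * ‖θ‖ := by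
  have hfac : character h' θ - character h θ = character h θ * (character (h' - h) θ - 1) := by
    unfold character
    rw [mul_sub, mul_one, ← Complex.exp_add, inner_sub_left]
    congr 2
    push_cast
    ring
  rw [hfac, norm_mul, norm_character, one_mul]
  exact Real.norm_exp_I_mul_ofReal_sub_one_le.trans (norm_inner_le_norm _ _)

variable {w k : E d → ℝ} {v c l η R : ℝ}

theorem weight_nonneg_le (hv : 0 < v) (hk0 : ∀ h, 0 ≤ k h) (hk1 : ∀ h, k h ≤ 1)
    (hkR : ∀ h, R < ‖h‖ → k h = 0) (hw : ∀ h, ‖h‖ ≤ R → v / 2 ≤ w h) (h : E d) :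
    0 ≤ k h / w h ∧ k h / w h ≤ 2 / v := by
  rcases le_or_gt ‖h‖ R with hR | hR
  · have h1 := hw h hR
    have h2 : 0 < w h := by linarith
    refine ⟨div_nonneg (hk0 h) h2.le, ?_⟩
    calc k h / w h ≤ 1 / (v / 2) := by
          gcongr
          exact hk1 h
      _ = 2 / v := by rw [one_div_div]
  · rw [hkR h hR]
    simp only [zero_div, le_refl, true_and]
    positivity

theorem weight_sub_le (hv : 0 < v) (hl : 0 ≤ l) (hc : 0 ≤ c) (hη : 0 ≤ η)
    (hk0 : ∀ h, 0 ≤ k h) (hk1 : ∀ h, k h ≤ 1)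
    (hkR : ∀ h, R < ‖h‖ → k h = 0) (hw : ∀ h, ‖h‖ ≤ R + η → v / 2 ≤ w h)
    (hkl : ∀ h h', ‖h' - h‖ ≤ η → |k h' - k h| ≤ l * η)
    (hwl : ∀ h h', ‖h' - h‖ ≤ η → |w h' - w h| ≤ c * η * v) {h h' : E d} (hh : ‖h' - h‖ ≤ η) :
    |k h' / w h' - k h / w h| ≤ 2 / v * ((l + 2 * c) * η) := by
  -- Unless both quotients vanish, one point is within `R` and the other within `R + η`, where the
  -- denominator is still controlled.
  by_cases hR : R < ‖h‖ ∧ R < ‖h'‖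
  · rw [hkR h hR.1, hkR h' hR.2]
    simp only [zero_div, sub_self, abs_zero]
    positivity
  have hb : ‖h‖ ≤ R + η ∧ ‖h'‖ ≤ R + η := by
    have h1 : ‖h‖ ≤ ‖h'‖ + ‖h' - h‖ := by
      rw [norm_sub_rev]
      exact norm_le_norm_add_norm_sub' h h'
    have h2 : ‖h'‖ ≤ ‖h‖ + ‖h' - h‖ := norm_le_norm_add_norm_sub' h' h
    by_cases h3 : R < ‖h‖
    · have h4 : ‖h'‖ ≤ R := not_lt.1 fun h5 => hR ⟨h3, h5⟩
      constructor <;> linarith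
    · constructor <;> linarith
  have hw1 := hw h hb.1
  have hw2 := hw h' hb.2
  have hp1 : 0 < w h := by linarith
  have hp2 : 0 < w h' := by linarith
  have hsplit : k h' / w h' - k h / w h
      = (k h' - k h) / w h' + k h * (w h - w h') / (w h * w h') := by
    field_simp
    ring
  have e1 : |(k h' - k h) / w h'| ≤ l * η / (v / 2) := by
    rw [abs_div, abs_of_pos hp2]
    gcongr
    exact hkl h h' hh
  have e2 : |k h * (w h - w h') / (w h * w h')| ≤ 1 * (c * η * v) / (v / 2 * (v / 2)) := by
    rw [abs_div, abs_mul, abs_of_pos (mul_pos hp1 hp2), abs_of_nonneg (hk0 h), abs_sub_comm]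
    gcongr
    · exact hk1 h
    · exact hwl h h' hh
  rw [hsplit]
  calc _ ≤ l * η / (v / 2) + 1 * (c * η * v) / (v / 2 * (v / 2)) :=
        (abs_add_le _ _).trans (add_le_add e1 e2)
    _ = 2 / v * ((l + 2 * c) * η) := by
      field_simp

theorem norm_weight_sub_le (hv : 0 < v) (hl : 0 ≤ l) (hc : 0 ≤ c) (hη : 0 ≤ η)
    (hk0 : ∀ h, 0 ≤ k h) (hk1 : ∀ h, k h ≤ 1)
    (hkR : ∀ h, R < ‖h‖ → k h = 0) (hw : ∀ h, ‖h‖ ≤ R + η → v / 2 ≤ w h)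
    (hkl : ∀ h h', ‖h' - h‖ ≤ η → |k h' - k h| ≤ l * η)
    (hwl : ∀ h h', ‖h' - h‖ ≤ η → |w h' - w h| ≤ c * η * v) {h h' θ : E d} {B : ℝ}
    (hθ : ‖θ‖ ≤ B) (hh : ‖h' - h‖ ≤ η) :
    ‖character h' θ * ((k h' / w h' : ℝ) : ℂ) - character h θ * ((k h / w h : ℝ) : ℂ)‖ ≤
      2 / v * ((B + l + 2 * c) * η) := by
  have hsplit : character h' θ * ((k h' / w h' : ℝ) : ℂ) - character h θ * ((k h / w h : ℝ) : ℂ)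
      = (character h' θ - character h θ) * ((k h' / w h' : ℝ) : ℂ)
        + character h θ * ((k h' / w h' - k h / w h : ℝ) : ℂ) := by
    push_cast
    ring
  have hwt := weight_nonneg_le hv hk0 hk1 hkR (fun h hR => hw h (by linarith)) h'
  have hB : 0 ≤ B := (norm_nonneg _).trans hθ
  rw [hsplit]
  calc _ ≤ η * B * (2 / v) + 1 * (2 / v * ((l + 2 * c) * η)) := by
        refine (norm_add_le _ _).trans (add_le_add ?_ ?_)
        · rw [norm_mul, Complex.norm_real, Real.norm_eq_abs, abs_of_nonneg hwt.1]
          have := norm_character_sub_le h h' θ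
          have h2 : ‖h' - h‖ * ‖θ‖ ≤ η * B := by gcongr
          exact mul_le_mul (this.trans h2) hwt.2 hwt.1 (by positivity)
        · rw [norm_mul, Complex.norm_real, Real.norm_eq_abs, norm_character]
          gcongr
          exact weight_sub_le hv hl hc hη hk0 hk1 hkR hw hkl hwl hh
    _ = _ := by ring

end Weights

/-! ### Expectation of the estimator. -/

section Expectation

variable {H : Type*} [NormedAddCommGroup H] [InnerProductSpace ℂ H]
variable {ι Ω : Type*} [MeasurableSpace Ω] {μ : Measure Ω}

theorem continuous_rankOne :
    Continuous fun p : H × H => InnerProductSpace.rankOne ℂ p.1 p.2 := by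
  have h : Continuous fun p : H × H => ContinuousLinearMap.smulRightL ℂ H H (innerSL ℂ p.2) p.1 :=
    ((ContinuousLinearMap.smulRightL ℂ H H).continuous.comp
      ((innerSL ℂ).continuous.comp continuous_snd)).clm_apply continuous_fst
  exact h

theorem integrable_rankOne {f g : Ω → H} (hf : MemLp f 2 μ) (hg : MemLp g 2 μ) :
    Integrable (fun ω => InnerProductSpace.rankOne ℂ (f ω) (g ω)) μ := by
  have hmeas : AEStronglyMeasurable (fun ω => InnerProductSpace.rankOne ℂ (f ω) (g ω)) μ := by
    have hpair : AEStronglyMeasurable (fun ω => (f ω, g ω)) μ := hf.1.prodMk hg.1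
    have h := (continuous_rankOne (H := H)).comp_aestronglyMeasurable hpair
    exact h
  have hprod : Integrable (fun ω => ‖f ω‖ * ‖g ω‖) μ := hf.norm.integrable_mul hg.norm
  refine hprod.mono hmeas (Eventually.of_forall fun ω => ?_)
  rw [InnerProductSpace.norm_rankOne, Real.norm_eq_abs, abs_of_nonneg (by positivity)]

variable [CompleteSpace H] {e : HilbertBasis ι ℂ H} {d : ℕ} {X : E d → Ω → H}

/-- The weight `exp(i h^⊤ θ) K(h / Δ) / |T ∩ (T - h)|` of the lag `h`. -/
def lagWeight (K : E d → ℝ) (T : Set (E d)) (Δ : ℝ) (θ h : E d) : ℂ :=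
  character h θ * ((K (Δ⁻¹ • h) / overlap T h : ℝ) : ℂ)

theorem integral_estimator (hX : IsSecondOrderStationary e X μ) (K : E d → ℝ) {n : ℕ}
    (t : Fin n → E d) (Δ : ℝ) (θ : E d) :
    ∫ ω, estimator X K t Δ θ ω ∂μ = (((2 * Real.pi) ^ d)⁻¹ : ℝ) •
      ∑ j, vol (cell t j) • ∑ i, vol (cell t i) •
        lagWeight K (region t) Δ θ (t i - t j) • statCov X μ (t i - t j) := by
  have hint : ∀ (c : ℂ) i j, Integrable
      (fun ω => c • InnerProductSpace.rankOne ℂ (X (t i) ω) (X (t j) ω)) μ := fun c i j =>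
    (integrable_rankOne (hX.memLp (t i)) (hX.memLp (t j))).smul c
  unfold estimator
  rw [integral_smul, integral_finsetSum _ fun i _ => integrable_finsetSum _ fun j _ => hint _ i j,
    Finset.sum_congr rfl fun i _ => integral_finsetSum _ fun j _ => hint _ i j, Finset.sum_comm]
  simp_rw [Finset.smul_sum]
  refine Finset.sum_congr rfl fun j _ => Finset.sum_congr rfl fun i _ => ?_
  rw [integral_smul]
  have hcov : ∫ ω, InnerProductSpace.rankOne ℂ (X (t i) ω) (X (t j) ω) ∂μ
      = statCov X μ (t i - t j) := hX.cov_lag _ _ _ _ (sub_zero _).symm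
  rw [hcov, ← Complex.coe_smul (vol (cell t j)), ← Complex.coe_smul (vol (cell t i)), smul_smul,
    smul_smul]
  congr 2
  unfold lagWeight overlap
  push_cast
  ring

end Expectation

/-! ### Kernel bias and discretization error. -/

section Bias

variable {H : Type*} [NormedAddCommGroup H] [InnerProductSpace ℂ H] [CompleteSpace H]
variable {ι : Type*} {e : HilbertBasis ι ℂ H} {d : ℕ} {C : E d → H →L[ℂ] H} {K : E d → ℝ}

theorem CovarianceCondition.integrable' {γ : ℝ} (hC : CovarianceCondition e C γ) :
    Integrable C :=
  ⟨hC.aestronglyMeasurable, (lintegral_mono fun h =>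
    (enorm_le_hsNorm e (C h)).trans (hsNorm_le_traceNorm e (C h))).trans_lt hC.integrable⟩

theorem integrable_character_smul (hC : Integrable C) (θ : E d) :
    Integrable fun h => character h θ • C h :=
  hC.bdd_smul 1 (continuous_character θ).aestronglyMeasurable
    (Eventually.of_forall fun h => (norm_character h θ).le)

theorem KernelCondition.abs_le_one (hK : KernelCondition K) (u : E d) : |K u| ≤ 1 := by
  rw [abs_of_nonneg (hK.nonneg u), ← hK.at_zero]
  exact hK.le_at_zero u

theorem integrable_kernel_smul (hC : Integrable C) (hK : KernelCondition K) (Δ : ℝ) (θ : E d) :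
    Integrable fun h => (character h θ * ((K (Δ⁻¹ • h) : ℝ) : ℂ)) • C h := by
  have hcont : Continuous fun h => character h θ * ((K (Δ⁻¹ • h) : ℝ) : ℂ) :=
    (continuous_character θ).mul
      (Complex.continuous_ofReal.comp (hK.continuous.comp (continuous_const_smul _)))
  refine hC.bdd_smul 1 hcont.aestronglyMeasurable (Eventually.of_forall fun h => ?_)
  rw [norm_mul, norm_character, one_mul, Complex.norm_real]
  exact hK.abs_le_one _

/-- Off `Δ S_K` the factor `1 - K(h/Δ)` equals `1`, so both right-hand integrals are pieces of one
integral with that factor. -/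
theorem integral_kernel_sub (hC : Integrable C) (hK : KernelCondition K) {Δ : ℝ} (hΔ : 0 < Δ)
    (θ : E d) :
    (∫ h, (character h θ * ((K (Δ⁻¹ • h) : ℝ) : ℂ)) • C h) - ∫ h, character h θ • C h =
      -((∫ h in Δ • posSet K, (character h θ * ((1 - K (Δ⁻¹ • h) : ℝ) : ℂ)) • C h) +
        ∫ h in (Δ • posSet K)ᶜ, character h θ • C h) := by
  have hmem : ∀ h, h ∈ Δ • posSet K ↔ 0 < K (Δ⁻¹ • h) := fun h => by
    rw [Set.mem_smul_set_iff_inv_smul_mem₀ hΔ.ne']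
    rfl
  have hm : MeasurableSet (Δ • posSet K) := by
    have : Δ • posSet K = {h | 0 < K (Δ⁻¹ • h)} := Set.ext hmem
    rw [this]
    exact (isOpen_lt continuous_const
      (hK.continuous.comp (continuous_const_smul _))).measurableSet
  have h1 := integrable_kernel_smul hC hK Δ θ
  have h2 := integrable_character_smul hC θ
  have hdiff : ∀ h, (character h θ * ((1 - K (Δ⁻¹ • h) : ℝ) : ℂ)) • C h
      = character h θ • C h - (character h θ * ((K (Δ⁻¹ • h) : ℝ) : ℂ)) • C h := fun h => by
    rw [← sub_smul]
    congr 1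
    push_cast
    ring
  have hcompl : ∫ h in (Δ • posSet K)ᶜ, character h θ • C h
      = ∫ h in (Δ • posSet K)ᶜ, (character h θ * ((1 - K (Δ⁻¹ • h) : ℝ) : ℂ)) • C h := by
    refine setIntegral_congr_fun hm.compl fun h hh => ?_
    have hz : K (Δ⁻¹ • h) = 0 :=
      le_antisymm (not_lt.1 fun hp => hh ((hmem h).2 hp)) (hK.nonneg _)
    simp [hz]
  have hint : Integrable fun h => (character h θ * ((1 - K (Δ⁻¹ • h) : ℝ) : ℂ)) • C h := by
    simp_rw [hdiff]
    exact h2.sub h1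
  rw [hcompl, integral_add_compl hm hint]
  simp_rw [hdiff]
  rw [integral_sub h2 h1, neg_sub]

theorem hsNorm_kernel_sub_le (hC : Integrable C) (hK : KernelCondition K) {Δ : ℝ} (hΔ : 0 < Δ)
    (θ : E d) :
    hsNorm e ((∫ h, (character h θ * ((K (Δ⁻¹ • h) : ℝ) : ℂ)) • C h) -
      ∫ h, character h θ • C h) ≤ biasOne e C K Δ θ + biasTwo e C K Δ θ := by
  rw [integral_kernel_sub hC hK hΔ, hsNorm_neg]
  exact hsNorm_add_le e _ _

variable {n : ℕ} {t : Fin n → E d} {c l Δ R B : ℝ} {θ : E d}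

/-- For the weight `ψ`, the splitting `ψ'C' - ψC = ψ'(C' - C) + (ψ' - ψ)C` gives a pointwise bound
with prefactor `2/|T|`. The factor `|T|` from the double quadrature leaves `2`. -/
theorem hsNorm_discretization_le (ht : Function.Injective t) (hC : Integrable C)
    (hosc : AEMeasurable (oscTr e C (2 * meshSize t))) (hK : KernelCondition K)
    (hv : 0 < vol (region t)) (hl : 0 ≤ l) (hc : 0 ≤ c)
    (hKR : ∀ h, R < ‖h‖ → K (Δ⁻¹ • h) = 0)
    (hw : ∀ h, ‖h‖ ≤ R + 2 * meshSize t → vol (region t) / 2 ≤ overlap (region t) h)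
    (hKl : ∀ h h', ‖h' - h‖ ≤ 2 * meshSize t →
      |K (Δ⁻¹ • h') - K (Δ⁻¹ • h)| ≤ l * (2 * meshSize t))
    (hwl : ∀ h h', ‖h' - h‖ ≤ 2 * meshSize t →
      |overlap (region t) h' - overlap (region t) h| ≤ c * (2 * meshSize t) * vol (region t))
    (hθ : ‖θ‖ ≤ B) :
    hsNorm e (∑ j, vol (cell t j) • ∑ i, vol (cell t i) •
        lagWeight K (region t) Δ θ (t i - t j) • C (t i - t j) -
      ∫ h, (character h θ * ((K (Δ⁻¹ • h) : ℝ) : ℂ)) • C h) ≤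
      2 * ((∫⁻ h, oscTr e C (2 * meshSize t) h) +
        ENNReal.ofReal ((B + l + 2 * c) * (2 * meshSize t)) * ∫⁻ h, traceNorm e (C h)) := by
  set T := region t with hT
  set v := vol T with hvdef
  set η := 2 * meshSize t with hηdef
  have hη : 0 ≤ η := mul_nonneg zero_le_two (meshSize_nonneg t)
  have hk0 : ∀ h : E d, 0 ≤ K (Δ⁻¹ • h) := fun h => hK.nonneg _
  have hk1 : ∀ h : E d, K (Δ⁻¹ • h) ≤ 1 := fun h => (le_abs_self _).trans (hK.abs_le_one _)
  have hw' : ∀ h, ‖h‖ ≤ R → v / 2 ≤ overlap T h := fun h hh => hw h (by linarith)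
  have hψ : ∀ h, ‖lagWeight K T Δ θ h‖ ≤ 2 / v := fun h => by
    have := weight_nonneg_le hv hk0 hk1 hKR hw' h
    rw [lagWeight, norm_mul, norm_character, one_mul, Complex.norm_real, Real.norm_eq_abs,
      abs_of_nonneg this.1]
    exact this.2
  have hg : Integrable fun h => lagWeight K T Δ θ h • C h := by
    refine hC.bdd_smul (2 / v) ?_ (Eventually.of_forall hψ)
    refine (continuous_character θ).aestronglyMeasurable.mul
      (Measurable.aestronglyMeasurable ?_)
    exact Complex.measurable_ofReal.comp
      ((hK.continuous.comp (continuous_const_smul _)).measurable.div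
        (measurable_overlap (isClosed_region t).measurableSet))
  have hb : ∀ h h', ‖h - h'‖ ≤ 2 * meshSize t →
      hsNorm e (lagWeight K T Δ θ h' • C h' - lagWeight K T Δ θ h • C h) ≤
        ENNReal.ofReal (2 / v) * (oscTr e C η h +
          ENNReal.ofReal ((B + l + 2 * c) * η) * traceNorm e (C h)) := by
    intro h h' hh
    have hsplit : lagWeight K T Δ θ h' • C h' - lagWeight K T Δ θ h • C h
        = lagWeight K T Δ θ h' • (C h' - C h)
          + (lagWeight K T Δ θ h' - lagWeight K T Δ θ h) • C h := by
      rw [smul_sub, sub_smul]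
      abel
    have hd := norm_weight_sub_le hv hl hc hη hk0 hk1 hKR hw hKl hwl hθ
      (show ‖h' - h‖ ≤ η by rwa [norm_sub_rev])
    have e1 : ‖lagWeight K T Δ θ h'‖ₑ ≤ ENNReal.ofReal (2 / v) := by
      rw [← ofReal_norm]
      exact ENNReal.ofReal_le_ofReal (hψ h')
    have e2 : ‖lagWeight K T Δ θ h' - lagWeight K T Δ θ h‖ₑ
        ≤ ENNReal.ofReal (2 / v) * ENNReal.ofReal ((B + l + 2 * c) * η) := by
      rw [← ofReal_norm, ← ENNReal.ofReal_mul (by positivity)]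
      exact ENNReal.ofReal_le_ofReal hd
    have e3 : hsNorm e (C h' - C h) ≤ oscTr e C η h :=
      (hsNorm_le_traceNorm e _).trans
        (le_iSup₂ (f := fun (y : E d) (_ : ‖h - y‖ ≤ η) => traceNorm e (C y - C h)) h' hh)
    rw [hsplit, mul_add, ← mul_assoc]
    refine (hsNorm_add_le e _ _).trans (add_le_add ?_ ?_)
    · exact (hsNorm_smul_le e _ _).trans (mul_le_mul' e1 e3)
    · exact (hsNorm_smul_le e _ _).trans (mul_le_mul' e2 (hsNorm_le_traceNorm e _))
  have hmain := hsNorm_double_quadrature_le e ht hg hb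
  have hcancel : ∀ h, overlap T h • lagWeight K T Δ θ h • C h
      = (character h θ * ((K (Δ⁻¹ • h) : ℝ) : ℂ)) • C h := fun h => by
    rw [← Complex.coe_smul (overlap T h), smul_smul]
    congr 1
    unfold lagWeight
    rcases le_or_gt ‖h‖ R with hR | hR
    · have h0 : (overlap T h : ℂ) ≠ 0 := by
        have := hw' h hR
        exact_mod_cast (show 0 < overlap T h by linarith).ne'
      push_cast
      field_simp
    · simp [hKR h hR]
  simp_rw [← hT, hcancel] at hmain
  refine hmain.trans (le_of_eq ?_)
  have hvol : volume T = ENNReal.ofReal v := (ENNReal.ofReal_toReal (volume_region_ne_top t)).symm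
  rw [lintegral_const_mul' _ _ ENNReal.ofReal_ne_top, lintegral_add_left' hosc,
    lintegral_const_mul' _ _ ENNReal.ofReal_ne_top, ← mul_assoc, hvol,
    ← ENNReal.ofReal_mul hv.le, mul_div_cancel₀ _ hv.ne']
  simp

end Bias

/-! ### Consequences of the sampling design for large `n`. -/

section Asymptotics

variable {d : ℕ} {t : (n : ℕ) → Fin n → E d}

theorem SamplingCondition.dim_ne_zero (ht : SamplingCondition t) : d ≠ 0 := by
  rintro rfl
  obtain ⟨n, hn⟩ := (ht.volume_region.eventually_gt_atTop (vol (Set.univ : Set (E 0)))).exists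
  exact hn.not_ge (ENNReal.toReal_mono (Set.toFinite _).isBounded.measure_lt_top.ne
    (measure_mono (Set.subset_univ _)))

/-- A ball of radius `s` in the limit shape forces one of radius `s/2` in the rescaled regions; the
scaling is then undone. -/
theorem SamplingCondition.exists_closedBall_subset (ht : SamplingCondition t) :
    ∃ r : ℝ, 0 < r ∧ ∀ᶠ n in atTop, ∃ x₀ : E d,
      Metric.closedBall x₀ (r * vol (region (t n)) ^ (1 / (d : ℝ))) ⊆ region (t n) := by
  obtain ⟨T, -, -, ⟨x, hx⟩, hlim⟩ := ht.shape
  obtain ⟨s, hs, hball⟩ := Metric.nhds_basis_closedBall.mem_iff.1 (mem_interior_iff_mem_nhds.1 hx)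
  have hr : 0 < s / 2 := by linarith
  refine ⟨s / 2, hr, ?_⟩
  filter_upwards [hlim.eventually_lt_const (ENNReal.ofReal_pos.2 hr),
    ht.volume_region.eventually_gt_atTop 0] with n hn hv
  set a := vol (region (t n)) ^ (1 / (d : ℝ)) with ha
  have hapos : 0 < a := Real.rpow_pos_of_pos hv _
  have hsub := closedBall_subset_of_hausdorffEDist_lt ((convex_region (t n)).smul a⁻¹)
    ((isClosed_region (t n)).smul₀ a⁻¹) hr (x₀ := x) (T := T)
    (by rwa [mul_div_cancel₀ _ two_ne_zero]) hn
  refine ⟨a • x, fun y hy => ?_⟩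
  have hy' : a⁻¹ • y ∈ Metric.closedBall x (s / 2) := by
    rw [mem_closedBall_iff_norm] at hy ⊢
    have : a⁻¹ • y - x = a⁻¹ • (y - a • x) := by
      rw [smul_sub, smul_smul, inv_mul_cancel₀ hapos.ne', one_smul]
    rw [this, norm_smul, Real.norm_eq_abs, abs_of_pos (inv_pos.2 hapos), inv_mul_le_iff₀ hapos]
    linarith
  obtain ⟨z, hz, hzy⟩ := hsub hy'
  rwa [← smul_right_injective _ (inv_ne_zero hapos.ne') hzy]

theorem SamplingCondition.eventually_overlap (ht : SamplingCondition t) {Δ : ℕ → ℝ}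
    (hΔ : Tendsto Δ atTop atTop)
    (hsmall : Tendsto (fun n => Δ n ^ d / vol (region (t n))) atTop (𝓝 0)) {R : ℝ} (hR : 0 ≤ R) :
    ∀ᶠ n in atTop,
      (∀ h, ‖h‖ ≤ R * Δ n + 1 → vol (region (t n)) / 2 ≤ overlap (region (t n)) h) ∧
      ∀ h h', ‖h' - h‖ ≤ 1 → |overlap (region (t n)) h' - overlap (region (t n)) h| ≤
        2 ^ d * ‖h' - h‖ * vol (region (t n)) := by
  obtain ⟨r, hr, hball⟩ := ht.exists_closedBall_subset
  have hd := ht.dim_ne_zero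
  -- Chosen so that `Δ < ε |T|^{1/d}` and `Δ ≥ 1` give `2^d (RΔ + 1) ≤ ρ/2`: the overlap then loses
  -- at most half of `|T|`.
  set ε := r / ((R + 1) * 2 ^ (d + 1)) with hε
  have hεpos : 0 < ε := by positivity
  filter_upwards [hball, ht.volume_region.eventually_gt_atTop 0, hΔ.eventually_ge_atTop 1,
    hsmall.eventually_lt_const (pow_pos hεpos d)] with n ⟨x₀, hx₀⟩ hv h1 hlt
  set T := region (t n) with hT
  set a := vol T ^ (1 / (d : ℝ)) with ha
  have hapos : 0 < a := Real.rpow_pos_of_pos hv _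
  have had : a ^ d = vol T := by
    rw [ha, one_div]
    exact Real.rpow_inv_natCast_pow hv.le hd
  have hΔa : Δ n < ε * a := by
    refine lt_of_pow_lt_pow_left₀ d (by positivity) ?_
    rw [mul_pow, had]
    exact (div_lt_iff₀ hv).1 hlt
  set ρ := r * a with hρdef
  have hρ : 0 < ρ := by positivity
  have hlarge : (R * Δ n + 1) * 2 ^ (d + 1) ≤ ρ := by
    calc (R * Δ n + 1) * 2 ^ (d + 1) ≤ ((R + 1) * (ε * a)) * 2 ^ (d + 1) := by
          gcongr
          nlinarith
      _ = ρ := by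
          rw [hε, hρdef]
          field_simp
  have hpow : (1 : ℝ) ≤ 2 ^ (d + 1) := one_le_pow₀ (by norm_num)
  have hRΔ : 0 ≤ R * Δ n := by positivity
  have hle : R * Δ n + 1 ≤ ρ := by nlinarith
  have hm : MeasurableSet T := (isClosed_region (t n)).measurableSet
  have key : ∀ h h', ‖h' - h‖ ≤ ρ →
      |overlap T h' - overlap T h| ≤ 2 ^ d * (‖h' - h‖ / ρ) * vol T := fun h h' hh =>
    abs_overlap_sub_le (convex_region (t n)) hm (volume_region_ne_top (t n)) hρ hx₀ hh
  refine ⟨fun h hh => ?_, fun h h' hh => ?_⟩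
  · have := key 0 h (by rw [sub_zero]; linarith)
    rw [sub_zero, overlap_zero] at this
    have h2 : 2 ^ d * (‖h‖ / ρ) ≤ 1 / 2 := by
      rw [← mul_div_assoc, div_le_iff₀ hρ]
      have : 2 ^ d * ‖h‖ ≤ 2 ^ d * (R * Δ n + 1) := by gcongr
      rw [pow_succ] at hlarge
      linarith
    have h3 := mul_le_mul_of_nonneg_right h2 hv.le
    have h4 := (abs_le.1 this).1
    linarith
  · refine (key h h' (by linarith)).trans ?_
    gcongr
    exact div_le_self (norm_nonneg _) (by linarith)

end Asymptotics

end SpectralBias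

end

/-! ### The bias bound. -/

open SpectralBias in
theorem mainTheorem5
    {H : Type*} [NormedAddCommGroup H] [InnerProductSpace ℂ H] [CompleteSpace H]
    [TopologicalSpace.SeparableSpace H]
    {ι : Type*} (e : HilbertBasis ι ℂ H)
    {Ω : Type*} [MeasurableSpace Ω] (μ : Measure Ω) [IsProbabilityMeasure μ]
    {d : ℕ} (X : E d → Ω → H)
    (hX : IsSecondOrderStationary e X μ) (hreal : IsRealProcess e X μ)
    (γ : ℝ) (hC : CovarianceCondition e (statCov X μ) γ)
    (K : E d → ℝ) (hK : KernelCondition K) (hLip : ∃ L : ℝ≥0, LipschitzWith L K)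
    (t : (n : ℕ) → Fin n → E d) (ht : SamplingCondition t)
    (Δ : ℕ → ℝ) (hΔ : Tendsto Δ atTop atTop)
    (hsub : ∀ᶠ n in atTop, Δ n • posSet K ⊆ region (t n) - region (t n))
    (hsmall : Tendsto (fun n => Δ n ^ d / vol (region (t n))) atTop (𝓝 0))
    (Θ : Set (E d)) (hΘ : Bornology.IsBounded Θ) :
    ∃ M : ℝ, ∀ᶠ n in atTop, ∀ θ ∈ Θ,
      hsNorm e ((∫ ω, estimator X K (t n) (Δ n) θ ω ∂μ) - spectralDensity (statCov X μ) θ) ≤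
        ENNReal.ofReal M * (ENNReal.ofReal (meshSize (t n) ^ γ) +
          biasOne e (statCov X μ) K (Δ n) θ + biasTwo e (statCov X μ) K (Δ n) θ) := by
  obtain ⟨L, hL⟩ := hLip
  obtain ⟨M₀, hM₀⟩ := hC.holder
  obtain ⟨R, hRpos, hR⟩ := hK.bounded_support.exists_pos_norm_le
  obtain ⟨B, hBpos, hB⟩ := hΘ.exists_pos_norm_le
  have hCint := hC.integrable'
  have : Nonempty (Fin d) := ⟨⟨0, Nat.pos_of_ne_zero ht.dim_ne_zero⟩⟩
  set I := (∫⁻ h, traceNorm e (statCov X μ h)).toReal with hI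
  have hI' : ∫⁻ h, traceNorm e (statCov X μ h) = ENNReal.ofReal I :=
    (ENNReal.ofReal_toReal hC.integrable.ne).symm
  have hI0 : 0 ≤ I := ENNReal.toReal_nonneg
  -- Increments of the character, the kernel and the overlap, in this order.
  set A := B + L + 2 * 2 ^ d with hA
  have hA0 : 0 ≤ A := by positivity
  set M := 2 * (|M₀| * 2 ^ γ + A * 2 * I) with hM
  have hM0 : 0 ≤ M := by positivity
  -- The extra `1` makes the coefficient of the two bias terms at least `1`.
  refine ⟨M + 1, ?_⟩
  -- With `δ < 1/2` the lag error `2δ` is below `1`, as both the Hölder condition and the overlap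
  -- bounds require.
  filter_upwards [ht.mesh.eventually_lt_const (show (0 : ℝ) < 1 / 2 by norm_num),
    ht.volume_region.eventually_gt_atTop 0, hΔ.eventually_ge_atTop 1,
    ht.eventually_overlap hΔ hsmall hRpos.le] with n hmesh hv h1 hover θ hθ
  have hΔpos : 0 < Δ n := by linarith
  have hδpos : 0 < meshSize (t n) := meshSize_pos hv
  set δ := meshSize (t n) with hδ
  have hosc := hM₀ (2 * δ) (by linarith) (by linarith)
  have hKR : ∀ h, R * Δ n < ‖h‖ → K ((Δ n)⁻¹ • h) = 0 := fun h hh => by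
    by_contra hne
    have hle := hR _ (lt_of_le_of_ne (hK.nonneg _) (Ne.symm hne))
    rw [norm_smul, Real.norm_eq_abs, abs_of_pos (inv_pos.2 hΔpos), inv_mul_le_iff₀ hΔpos] at hle
    linarith
  have hKl : ∀ h h', ‖h' - h‖ ≤ 2 * δ →
      |K ((Δ n)⁻¹ • h') - K ((Δ n)⁻¹ • h)| ≤ L * (2 * δ) := fun h h' hh => by
    have hdist := hL.dist_le_mul ((Δ n)⁻¹ • h') ((Δ n)⁻¹ • h)
    rw [Real.dist_eq, dist_eq_norm, ← smul_sub, norm_smul, Real.norm_eq_abs,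
      abs_of_pos (inv_pos.2 hΔpos)] at hdist
    refine hdist.trans (mul_le_mul_of_nonneg_left ?_ L.coe_nonneg)
    exact (mul_le_of_le_one_left (norm_nonneg _) (inv_le_one_of_one_le₀ h1)).trans hh
  have hdisc := hsNorm_discretization_le (e := e) (c := 2 ^ d) (ht.distinct n) hCint hosc.1 hK hv
    L.coe_nonneg (by positivity) hKR (fun h hh => hover.1 h (by linarith)) hKl
    (fun h h' hh => (hover.2 h h' (by linarith)).trans (by gcongr)) (hB θ hθ)
  have hδγ : δ ≤ δ ^ γ := by
    conv_lhs => rw [← Real.rpow_one δ]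
    exact Real.rpow_le_rpow_of_exponent_ge hδpos (by linarith) hC.gamma_le_one
  have hδγ0 : 0 ≤ δ ^ γ := Real.rpow_nonneg hδpos.le γ
  have hbound : 2 * ((∫⁻ h, oscTr e (statCov X μ) (2 * δ) h) +
      ENNReal.ofReal (A * (2 * δ)) * ∫⁻ h, traceNorm e (statCov X μ h)) ≤
      ENNReal.ofReal (M * δ ^ γ) := by
    have h2 : ENNReal.ofReal 2 = 2 := by simp
    rw [hI', ← ENNReal.ofReal_mul (by positivity)]
    calc _ ≤ 2 * (ENNReal.ofReal (|M₀| * 2 ^ γ * δ ^ γ) +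
          ENNReal.ofReal (A * 2 * I * δ ^ γ)) := by
          refine mul_le_mul_right (add_le_add ?_ (ENNReal.ofReal_le_ofReal ?_)) 2
          · refine hosc.2.trans (ENNReal.ofReal_le_ofReal ?_)
            rw [Real.mul_rpow zero_le_two hδpos.le, ← mul_assoc]
            gcongr
            exact le_abs_self M₀
          · have := mul_le_mul_of_nonneg_left hδγ (show 0 ≤ A * 2 * I by positivity)
            linarith
      _ = ENNReal.ofReal (M * δ ^ γ) := by
          rw [← ENNReal.ofReal_add (by positivity) (by positivity), ← h2,
            ← ENNReal.ofReal_mul zero_le_two]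
          congr 1
          rw [hM]
          ring
  have hscale : ‖(((2 * Real.pi) ^ d)⁻¹ : ℝ)‖ₑ ≤ 1 := by
    have hpi : (1 : ℝ) ≤ 2 * Real.pi := by linarith [Real.pi_gt_three]
    rw [Real.enorm_of_nonneg (by positivity), ENNReal.ofReal_le_one]
    exact inv_le_one_of_one_le₀ (one_le_pow₀ hpi)
  have hker := hsNorm_kernel_sub_le (e := e) hCint hK hΔpos θ
  rw [integral_estimator hX, spectralDensity, ← smul_sub]
  refine (hsNorm_real_smul_le e _ _).trans ((mul_le_of_le_one_left zero_le hscale).trans ?_)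
  rw [← sub_add_sub_cancel _ (∫ h, (character h θ * ((K ((Δ n)⁻¹ • h) : ℝ) : ℂ)) • statCov X μ h) _]
  refine (hsNorm_add_le e _ _).trans ((add_le_add (hdisc.trans hbound) hker).trans ?_)
  rw [add_assoc, mul_add]
  refine add_le_add ?_ (le_mul_of_one_le_left zero_le ?_)
  · rw [← ENNReal.ofReal_mul (by positivity)]
    gcongr
    linarith
  · rw [ENNReal.one_le_ofReal]
    linarith
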